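/- **Proposition 1.2.** For $m\ge 0$ let $P_m$ be the path with $m$ vertices, and for $n\ge 1$ let $C_n$ be the cycle with $n$ vertices, i.e. the graph on $\mathbb{Z}/n$ in which consecutive vertices are adjacent; thus $P_0$ is the empty graph, $C_2=P_2$, and $C_1$ is a single vertex with a loop. Let $G\times H$ denote the Cartesian (grid) product of graphs. For a graph $G$ let $\mathrm{Ind}(G)$ be its independence complex, the simplicial complex whose faces are the independent sets of $G$ (a vertex with a loop lies in no independent set; if $G$ has no nonempty independent set, then $\mathrm{Ind}(G)$ is the empty space $\emptyset=S^{-1}$). Let $\Sigma K=S^0\ast K$ denote the unreduced suspension, so that $\Sigma\emptyset=S^0$. Then we have the following homotopy equivalences: - $\mathrm{Ind}(P_1\times P_n)\simeq \Sigma\,\mathrm{Ind}(P_1\times P_{n-3})$ for all $n\ge 3$, - $\mathrm{Ind}(P_2\times P_n)\simeq \Sigma\,\mathrm{Ind}(P_2\times P_{n-2})$ for all $n\ge 2$, - $\mathrm{Ind}(P_3\times P_n)\simeq \Sigma^3\,\mathrm{Ind}(P_3\times P_{n-4})$ for all $n\ge 4$, - $\mathrm{Ind}(C_3\times C_n)\simeq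 \Sigma^2\,\mathrm{Ind}(C_3\times C_{n-3})$ for all $n\ge 4$. -/

import Mathlib

namespace HardSquares

/-- An undirected graph without multiple edges in which loops are allowed. -/
@[ext]
structure LoopGraph (V : Type*) where
  /-- The adjacency relation; `Adj v v` means that there is a loop at `v`. -/
  Adj : V → V → Prop
  symm : ∀ u v, Adj u v → Adj v u

namespace LoopGraph

/-- A simple graph, viewed as a graph without loops. -/
def ofSimpleGraph {V : Type*} (G : SimpleGraph V) : LoopGraph V where
  Adj := G.Adj
  symm _ _ h := h.symm

/-- The path `P_n` with `n` vertices (`P_0` is the empty graph). -/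
def path (n : ℕ) : LoopGraph (Fin n) := ofSimpleGraph (SimpleGraph.pathGraph n)

/-- The cycle `C_n` on the vertices `0, …, n - 1`: `u` and `v` are adjacent when they are
consecutive modulo `n`. For `n ≥ 3` this is the usual cycle, `C_2 = P_2`, `C_1` is a single vertex
with a loop, and `C_0` is the empty graph. -/
def cycle (n : ℕ) : LoopGraph (Fin n) where
  Adj u v := (u.val + 1) % n = v.val ∨ (v.val + 1) % n = u.val
  symm _ _ h := h.symm

/-- The Cartesian (box) product of two graphs, as in `SimpleGraph.boxProd`. -/
def prod {V W : Type*} (G : LoopGraph V) (H : LoopGraph W) : LoopGraph (V × W) where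
  Adj x y := G.Adj x.1 y.1 ∧ x.2 = y.2 ∨ H.Adj x.2 y.2 ∧ x.1 = y.1
  symm _ _ h := h.imp (fun h => ⟨G.symm _ _ h.1, h.2.symm⟩) (fun h => ⟨H.symm _ _ h.1, h.2.symm⟩)

/-- The independence complex `Ind(G)`: its faces are the nonempty finite sets of vertices that
contain no edge and no looped vertex (`u = v` is allowed below). -/
def ind {V : Type*} (G : LoopGraph V) : PreAbstractSimplicialComplex V where
  faces := {s | s.Nonempty ∧ ∀ u ∈ s, ∀ v ∈ s, ¬ G.Adj u v}
  isRelLowerSet_faces := fun _ h =>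
    ⟨h.1, fun _ hts ht => ⟨ht, fun u hu v hv => h.2 u (hts hu) v (hts hv)⟩⟩

theorem prod_ofSimpleGraph {V W : Type*} (G : SimpleGraph V) (H : SimpleGraph W) :
    (ofSimpleGraph G).prod (ofSimpleGraph H) = ofSimpleGraph (G.boxProd H) := rfl

theorem mem_ind_ofSimpleGraph {V : Type*} (G : SimpleGraph V) (s : Finset V) :
    s ∈ (ofSimpleGraph G).ind.faces ↔ s.Nonempty ∧ G.IsIndepSet (s : Set V) := by
  refine and_congr_right fun _ => ⟨fun h u hu v hv _ => h u hu v hv, fun h u hu v hv e => ?_⟩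
  exact h hu hv (G.ne_of_adj e) e

theorem cycle_eq (n : ℕ) (hn : n ≠ 1) : cycle n = ofSimpleGraph (SimpleGraph.cycleGraph n) := by
  rcases n with _ | _ | n
  · ext u; exact u.elim0
  · exact absurd rfl hn
  · ext u v
    change (_ ∨ _) ↔ (SimpleGraph.cycleGraph (n + 2)).Adj u v
    rw [SimpleGraph.cycleGraph_adj, sub_eq_iff_eq_add', sub_eq_iff_eq_add', or_comm]
    simp only [Fin.ext_iff, Fin.val_add, Fin.val_one]
    simp only [add_comm, eq_comm]

theorem cycle_one_adj (u v : Fin 1) : (cycle 1).Adj u v := by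
  refine Or.inl ?_
  omega

end LoopGraph

/-- The complex `S⁰` consisting of two isolated vertices. -/
def twoPoints : PreAbstractSimplicialComplex Bool where
  faces := {s | ∃ b, s = {b}}
  isRelLowerSet_faces := by
    rintro _ ⟨b, rfl⟩
    exact ⟨Finset.singleton_nonempty b, fun _ hts ht => ⟨b, (Finset.Nonempty.subset_singleton_iff ht).1 hts⟩⟩

/-- The join `K * L`: the nonempty disjoint unions `σ ⊔ τ`, where `σ` is a face of `K` or empty and
`τ` is a face of `L` or empty. -/
def join {V W : Type*} (K : PreAbstractSimplicialComplex V) (L : PreAbstractSimplicialComplex W) :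
    PreAbstractSimplicialComplex (V ⊕ W) where
  faces := {s | s.Nonempty ∧ (s.toLeft = ∅ ∨ s.toLeft ∈ K.faces) ∧
    (s.toRight = ∅ ∨ s.toRight ∈ L.faces)}
  isRelLowerSet_faces := by
    rintro s ⟨hs, hK, hL⟩
    refine ⟨hs, fun t hts ht => ⟨ht, ?_, ?_⟩⟩
    · rcases t.toLeft.eq_empty_or_nonempty with h | h
      · exact Or.inl h
      · have hsub := Finset.toLeft_subset_toLeft hts
        rcases hK with hK | hK
        · exact absurd (Finset.subset_empty.1 (hK ▸ hsub)) h.ne_empty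
        · exact Or.inr ((K.isRelLowerSet_faces hK).2 hsub h)
    · rcases t.toRight.eq_empty_or_nonempty with h | h
      · exact Or.inl h
      · have hsub := Finset.toRight_subset_toRight hts
        rcases hL with hL | hL
        · exact absurd (Finset.subset_empty.1 (hL ▸ hsub)) h.ne_empty
        · exact Or.inr ((L.isRelLowerSet_faces hL).2 hsub h)

/-- The unreduced suspension `Σ K = S⁰ * K`. The suspension of the empty complex is `S⁰`. -/
def susp {V : Type*} (K : PreAbstractSimplicialComplex V) :
    PreAbstractSimplicialComplex (Bool ⊕ V) :=
  join twoPoints K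

/-- The geometric realization of a simplicial complex on a finite set `V` of vertices: the union of
the simplices spanned by its faces inside the standard simplex (barycentric coordinates), with the
subspace topology from `V → ℝ`. It is empty when the complex has no faces. -/
def realization {V : Type*} [Fintype V] (K : PreAbstractSimplicialComplex V) : Set (V → ℝ) :=
  {x | x ∈ stdSimplex ℝ V ∧ ∃ s ∈ K.faces, ∀ v, v ∉ s → x v = 0}

/-- Homotopy equivalence of (the geometric realizations of) two simplicial complexes. -/
def HomotopyEquivalent {V W : Type*} [Fintype V] [Fintype W]
    (K : PreAbstractSimplicialComplex V) (L : PreAbstractSimplicialComplex W) : Prop :=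
  Nonempty (ContinuousMap.HomotopyEquiv (realization K) (realization L))

end HardSquares

/-!
Deleting a vertex of a graph has the same effect on the independence complex as adding a loop to
it, so all changes of a graph below are additions or removals of (possibly looped) edges on a fixed
vertex set. The single source of homotopy equivalences is
`LoopGraph.ind_homotopyEquivalent_of_add_edge`: adding an edge `uv` removes the open star of the
face `{u, v}` from the complex, and if all neighbours of some vertex `a` are neighbours of `u` or
`v`, then the link of that face is a cone with apex `a`, so that the removal is a collapse. The
collapse moves the common part of the coordinates of `u` and `v` to the coordinate of `a`, and is
homotopic to the identity along straight lines (`homotopyEquivalent_of_link_cone`).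

In each of the four families, a sequence of such moves near a few consecutive columns of the grid
turns the graph into the smaller grid together with `1`, `1`, `3` or `2` disjoint edges, up to
looped vertices. Every disjoint edge contributes one suspension (`LoopGraph.ind_edgeSum`). For the
paths, the moves delete the first of the last columns, after which the remaining vertices split
off. For `C_3 × C_n`, three columns are bypassed by joining the two columns next to them, then cut
off and reduced to two disjoint edges.

The moves only use apices `a` lying strictly inside the modified region, all of whose neighbours
carry one of finitely many labels. Their validity is therefore a statement about a finite list of
edges, independent of `n`, which is checked by `decide`
(`LoopGraph.IsInterior.homotopyEquivalent_of_validMoves`). Vertices may carry several labels, which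
covers the short cycles where the columns on both sides of the modified region coincide.
-/

namespace HardSquares

open Finset

/-! ### Maps between geometric realizations -/

section Topology

variable {V W : Type*} [Fintype V] [Fintype W]

/-- Two continuous maps into a realization are homotopic along straight lines, provided that
their values at each point lie in a common simplex. -/
theorem homotopic_of_common_face {X : Type*} [TopologicalSpace X]
    {K : PreAbstractSimplicialComplex V} (f g : C(X, realization K))
    (h : ∀ x, ∃ s ∈ K.faces, ∀ v, v ∉ s → (f x).1 v = 0 ∧ (g x).1 v = 0) : f.Homotopic g := by
  refine ⟨{ toFun := fun p => ⟨fun v => (1 - (p.1 : ℝ)) * (f p.2).1 v + (p.1 : ℝ) * (g p.2).1 v,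
              ?_, ?_⟩
            continuous_toFun := ?_
            map_zero_left := ?_
            map_one_left := ?_ }⟩
  · exact convex_stdSimplex ℝ V (f p.2).2.1 (g p.2).2.1 (sub_nonneg.2 p.1.2.2) p.1.2.1 (by ring)
  · obtain ⟨s, hs, hv⟩ := h p.2
    exact ⟨s, hs, fun v hvs => by simp [hv v hvs]⟩
  · refine Continuous.subtype_mk (continuous_pi fun v => ?_) _
    have hf : Continuous fun p : unitInterval × X => (f p.2).1 v :=
      (continuous_apply v).comp (continuous_subtype_val.comp (f.continuous.comp continuous_snd))
    have hg : Continuous fun p : unitInterval × X => (g p.2).1 v :=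
      (continuous_apply v).comp (continuous_subtype_val.comp (g.continuous.comp continuous_snd))
    have ht : Continuous fun p : unitInterval × X => (p.1 : ℝ) :=
      continuous_subtype_val.comp continuous_fst
    exact ((continuous_const.sub ht).mul hf).add (ht.mul hg)
  · intro x; ext v; simp
  · intro x; ext v; simp

theorem HomotopyEquivalent.symm {K : PreAbstractSimplicialComplex V}
    {L : PreAbstractSimplicialComplex W} (h : HomotopyEquivalent K L) : HomotopyEquivalent L K :=
  h.map fun e => e.symm

theorem HomotopyEquivalent.refl (K : PreAbstractSimplicialComplex V) : HomotopyEquivalent K K :=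
  ⟨ContinuousMap.HomotopyEquiv.refl _⟩

theorem HomotopyEquivalent.trans {U : Type*} [Fintype U] {K : PreAbstractSimplicialComplex V}
    {L : PreAbstractSimplicialComplex W} {M : PreAbstractSimplicialComplex U}
    (h : HomotopyEquivalent K L) (h' : HomotopyEquivalent L M) : HomotopyEquivalent K M :=
  let ⟨e⟩ := h; let ⟨e'⟩ := h'; ⟨e.trans e'⟩

/-- A point of a realization whose coordinates vanish outside a finite set `s` lies in a face
contained in `s`. -/
theorem mem_realization_of_subset [DecidableEq V] {K : PreAbstractSimplicialComplex V}
    {x : V → ℝ} (hx : x ∈ stdSimplex ℝ V) {s t : Finset V} (hs : s ∈ K.faces)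
    (hxs : ∀ v, v ∉ s → x v = 0) (hxt : ∀ v, v ∉ t → x v = 0) :
    x ∈ stdSimplex ℝ V ∧ ∃ r ∈ K.faces, r ⊆ t ∧ ∀ v, v ∉ r → x v = 0 := by
  have h0 : ∀ v, v ∉ s ∩ t → x v = 0 := fun v hv => by
    by_cases h : v ∈ s
    · exact hxt v fun h' => hv (mem_inter.2 ⟨h, h'⟩)
    · exact hxs v h
  refine ⟨hx, s ∩ t, (K.isRelLowerSet_faces hs).2 inter_subset_left ?_, inter_subset_right, h0⟩
  by_contra hne
  rw [not_nonempty_iff_eq_empty] at hne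
  have : ∑ v, x v = 0 := sum_eq_zero fun v _ => h0 v (by simp [hne])
  rw [hx.2] at this
  exact one_ne_zero this

/-- The collapse pushing the mass that a point carries on all of `σ` to the vertex `a`: the least
of the coordinates indexed by `σ` is subtracted from each of them. -/
noncomputable def pushToVertex [DecidableEq V] (σ : Finset V) (hσ : σ.Nonempty) (a : V)
    (x : V → ℝ) : V → ℝ :=
  fun v => x v - (if v ∈ σ then σ.inf' hσ x else 0) + if v = a then #σ * σ.inf' hσ x else 0

/-- If the link of the face `σ` is a cone with apex `a`, deleting the open star of `σ` does not
change the homotopy type. -/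
theorem homotopyEquivalent_of_link_cone [DecidableEq V] {K K' : PreAbstractSimplicialComplex V}
    (σ : Finset V) (hσ : σ.Nonempty) (a : V) (ha : a ∉ σ)
    (hK' : ∀ s, s ∈ K'.faces ↔ s ∈ K.faces ∧ ¬ σ ⊆ s)
    (hcone : ∀ s ∈ K.faces, σ ⊆ s → insert a s ∈ K.faces) : HomotopyEquivalent K K' := by
  set r := pushToVertex σ hσ a with hr
  have hm0 : ∀ x ∈ stdSimplex ℝ V, 0 ≤ σ.inf' hσ x := fun x hx =>
    le_inf' hσ _ fun v _ => hx.1 v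
  have hcont : Continuous r := by
    refine continuous_pi fun v => ?_
    have hm : Continuous fun x : V → ℝ => σ.inf' hσ x := by
      have := Continuous.finset_inf'_apply (f := fun (v : V) (x : V → ℝ) => x v) hσ
        (fun i _ => continuous_apply i)
      simpa using this
    have hm1 : Continuous fun x : V → ℝ => if v ∈ σ then σ.inf' hσ x else 0 := by
      split_ifs <;> fun_prop
    have hm2 : Continuous fun x : V → ℝ => if v = a then #σ * σ.inf' hσ x else 0 := by
      split_ifs <;> fun_prop
    exact ((continuous_apply v).sub hm1).add hm2
  have hsimp : ∀ x ∈ stdSimplex ℝ V, r x ∈ stdSimplex ℝ V := by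
    intro x hx
    refine ⟨fun v => ?_, ?_⟩
    · have h1 : (if v ∈ σ then σ.inf' hσ x else 0) ≤ x v := by
        split_ifs with h
        · exact inf'_le _ h
        · exact hx.1 v
      have h2 : 0 ≤ if v = a then #σ * σ.inf' hσ x else 0 := by
        split_ifs
        · exact mul_nonneg (Nat.cast_nonneg _) (hm0 x hx)
        · exact le_rfl
      simp only [hr, pushToVertex]; linarith
    · simp [hr, pushToVertex, sum_add_distrib, sum_sub_distrib, hx.2]
  -- A point already in `K'` has a vanishing coordinate on `σ`, so it is fixed.
  have hfix : ∀ x ∈ realization K', r x = x := by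
    rintro x ⟨hx, s, hs, hxs⟩
    obtain ⟨v, hvσ, hvs⟩ := Finset.not_subset.1 ((hK' s).1 hs).2
    have : σ.inf' hσ x = 0 := le_antisymm ((inf'_le _ hvσ).trans (hxs v hvs).le) (hm0 x hx)
    funext w; simp [hr, pushToVertex, this]
  have hsub : ∀ x ∈ realization K', x ∈ realization K := fun x hx =>
    ⟨hx.1, let ⟨s, hs, h⟩ := hx.2; ⟨s, ((hK' s).1 hs).1, h⟩⟩
  have hmain : ∀ x ∈ realization K, r x ∈ realization K' ∧
      ∃ s ∈ K.faces, ∀ v, v ∉ s → r x v = 0 ∧ x v = 0 := by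
    rintro x ⟨hx, s, hs, hxs⟩
    obtain ⟨v₀, hv₀, hmin⟩ := exists_mem_eq_inf' hσ x
    by_cases hsub' : ∃ v ∈ σ, x v = 0
    · obtain ⟨v, hvσ, hv⟩ := hsub'
      have hz : σ.inf' hσ x = 0 := le_antisymm ((inf'_le _ hvσ).trans hv.le) (hm0 x hx)
      have hrx : r x = x := by funext w; simp [hr, pushToVertex, hz]
      obtain ⟨-, t, ht, htv, hxt⟩ := mem_realization_of_subset (t := univ.erase v) hx hs hxs
        (fun w hw => by
          have : w = v := by simpa using hw
          rw [this, hv])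
      rw [hrx]
      refine ⟨⟨hx, t, (hK' t).2 ⟨ht, fun h => ?_⟩, hxt⟩, s, hs, fun w hw => ⟨hxs w hw, hxs w hw⟩⟩
      simpa using htv (h hvσ)
    · push Not at hsub'
      have hσs : σ ⊆ s := fun v hv => by
        by_contra h; exact hsub' v hv (hxs v h)
      have hins := hcone s hs hσs
      have hrs : ∀ v, v ∉ insert a s → r x v = 0 := fun v hv => by
        rw [mem_insert, not_or] at hv
        have hvσ : v ∉ σ := fun h => hv.2 (hσs h)
        simp [hr, pushToVertex, hv.1, hxs v hv.2, hvσ]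
      have hv₀a : v₀ ≠ a := fun h => ha (h ▸ hv₀)
      obtain ⟨h1, t, ht, htv, hxt⟩ := mem_realization_of_subset (t := univ.erase v₀)
        (hsimp x hx) hins hrs (fun w hw => by
          have : w = v₀ := by simpa using hw
          rw [this]; simp [hr, pushToVertex, hv₀, hv₀a, hmin])
      refine ⟨⟨h1, t, (hK' t).2 ⟨ht, fun h => ?_⟩, hxt⟩, _, hins, fun w hw => ⟨hrs w hw, ?_⟩⟩
      · simpa using htv (h hv₀)
      · exact hxs w fun h => hw (mem_insert_of_mem h)
  refine ⟨⟨⟨fun x => ⟨r x.1, (hmain x.1 x.2).1⟩, by fun_prop⟩,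
    ⟨fun x => ⟨x.1, hsub x.1 x.2⟩, by fun_prop⟩, ?_, ?_⟩⟩
  · exact homotopic_of_common_face _ _ fun x => (hmain x.1 x.2).2
  · convert ContinuousMap.Homotopic.refl _
    ext x v
    simp [hfix x.1 x.2]

/-- Complexes which agree up to renaming vertices, and up to vertices lying in no face, are
homotopy equivalent (indeed homeomorphic). -/
theorem homotopyEquivalent_of_injective {K : PreAbstractSimplicialComplex V}
    {L : PreAbstractSimplicialComplex W} (g : W ↪ V)
    (hg : ∀ s : Finset W, s.map g ∈ K.faces ↔ s ∈ L.faces)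
    (hrange : ∀ s ∈ K.faces, ∀ v ∈ s, v ∈ Set.range g) : HomotopyEquivalent K L := by
  classical
  have hface : ∀ s ∈ K.faces, ∃ t ∈ L.faces, t.map g = s := fun s hs => by
    obtain ⟨t, rfl⟩ : ∃ t : Finset W, t.map g = s := by
      refine ⟨s.preimage g g.injective.injOn, ?_⟩
      ext v
      simp only [mem_map, mem_preimage]
      constructor
      · rintro ⟨w, hw, rfl⟩; exact hw
      · intro hv
        obtain ⟨w, rfl⟩ := hrange s hs v hv
        exact ⟨w, hv, rfl⟩
    exact ⟨t, (hg t).1 hs, rfl⟩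
  have hsum : ∀ x : V → ℝ, (∀ v, v ∉ Set.range g → x v = 0) → ∑ w, x (g w) = ∑ v, x v :=
    fun x hx => by
      rw [← sum_map univ g x]
      exact sum_subset (subset_univ _) fun v _ hv => hx v (by simpa using hv)
  have hext : ∀ (y : W → ℝ) w, Function.extend g y 0 (g w) = y w := fun y w =>
    g.injective.extend_apply _ _ _
  have hext0 : ∀ (y : W → ℝ) v, v ∉ Set.range g → Function.extend g y 0 v = 0 := fun y v hv =>
    Function.extend_apply' _ _ _ (by simpa using hv)
  have hto : ∀ x ∈ realization K, (fun w => x (g w)) ∈ realization L := by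
    rintro x ⟨hx, s, hs, hxs⟩
    obtain ⟨t, ht, rfl⟩ := hface s hs
    refine ⟨⟨fun w => hx.1 _, ?_⟩, t, ht, fun w hw => hxs _ (by simpa using hw)⟩
    rw [hsum x fun v hv => hxs v fun h => hv (hrange _ hs v h)]
    exact hx.2
  have hinv : ∀ y ∈ realization L, Function.extend g y 0 ∈ realization K := by
    rintro y ⟨hy, t, ht, hyt⟩
    refine ⟨⟨fun v => ?_, ?_⟩, t.map g, (hg t).2 ht, fun v hv => ?_⟩
    · by_cases h : v ∈ Set.range g
      · obtain ⟨w, rfl⟩ := h; rw [hext]; exact hy.1 w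
      · rw [hext0 y v h]
    · rw [← hsum _ (hext0 y)]; simp only [hext]; exact hy.2
    · by_cases h : v ∈ Set.range g
      · obtain ⟨w, rfl⟩ := h; rw [hext]; exact hyt w (by simpa using hv)
      · exact hext0 y v h
  have hcont : Continuous fun y : W → ℝ => Function.extend g y 0 := by
    refine continuous_pi fun v => ?_
    by_cases h : v ∈ Set.range g
    · obtain ⟨w, rfl⟩ := h; simp only [hext]; exact continuous_apply w
    · simp only [hext0 _ v h]; exact continuous_const
  have hcont' : Continuous fun (x : realization K) w => x.1 (g w) :=
    continuous_pi fun w => (continuous_apply (g w)).comp continuous_subtype_val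
  refine ⟨⟨⟨fun x => ⟨_, hto x.1 x.2⟩, hcont'.subtype_mk _⟩,
    ⟨fun y => ⟨_, hinv y.1 y.2⟩, (hcont.comp continuous_subtype_val).subtype_mk _⟩, ?_, ?_⟩⟩
  · convert ContinuousMap.Homotopic.refl _
    ext x v
    obtain ⟨x, hx, s, hs, hxs⟩ := x
    by_cases h : v ∈ Set.range g
    · obtain ⟨w, rfl⟩ := h; simp [hext]
    · simp [hext0 _ v h, hxs v fun h' => h (hrange s hs v h')]
  · convert ContinuousMap.Homotopic.refl _
    ext y w
    simp [hext]

end Topology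

/-! ### Independence complexes under changes of the graph -/

namespace LoopGraph

variable {V W L : Type*}

/-- Adding the edge `uv` (a loop at `u` if `u = v`, which deletes `u` from the independence
complex) preserves the homotopy type if the neighbours of some other vertex `a` are neighbours of
`u` or of `v`, apart from looped ones. Indeed, the link of `{u, v}` is then a cone with
apex `a`. -/
theorem ind_homotopyEquivalent_of_add_edge [Fintype V] {G G' : LoopGraph V} (u v a : V)
    (hau : a ≠ u) (hav : a ≠ v) (haa : ¬ G.Adj a a)
    (ha : ∀ x, G.Adj a x → G.Adj x x ∨ G.Adj u x ∨ G.Adj v x)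
    (hG' : ∀ x y, G'.Adj x y ↔ G.Adj x y ∨ (x = u ∧ y = v) ∨ (x = v ∧ y = u)) :
    HomotopyEquivalent G.ind G'.ind := by
  classical
  refine homotopyEquivalent_of_link_cone {u, v} (by simp) a (by simp [hau, hav]) ?_ ?_
  · intro s
    constructor
    · rintro ⟨hne, hs⟩
      refine ⟨⟨hne, fun x hx y hy h => hs x hx y hy ((hG' x y).2 (Or.inl h))⟩, fun hσ => ?_⟩
      exact hs u (hσ (by simp)) v (hσ (by simp)) ((hG' u v).2 (by simp))
    · rintro ⟨⟨hne, hs⟩, hσ⟩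
      refine ⟨hne, fun x hx y hy h => ?_⟩
      rcases (hG' x y).1 h with h | ⟨rfl, rfl⟩ | ⟨rfl, rfl⟩
      · exact hs x hx y hy h
      · exact hσ (by simp [insert_subset_iff, hx, hy])
      · exact hσ (by simp [insert_subset_iff, hx, hy])
  · rintro s ⟨-, hs⟩ hσ
    have hu : u ∈ s := hσ (by simp)
    have hv : v ∈ s := hσ (by simp)
    have hax : ∀ x ∈ s, ¬ G.Adj a x := fun x hx h => by
      rcases ha x h with h | h | h
      exacts [hs x hx x hx h, hs u hu x hx h, hs v hv x hx h]
    refine ⟨insert_nonempty _ _, fun x hx y hy h => ?_⟩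
    rcases mem_insert.1 hx with rfl | hxs <;> rcases mem_insert.1 hy with rfl | hys
    exacts [haa h, hax y hys h, hax x hxs (G.symm _ _ h), hs x hxs y hys h]

/-- If `G'` is the subgraph of `G` induced on the image of `g` and all other vertices of `G` are
looped, then `G` and `G'` have the same independence complex. -/
theorem ind_homotopyEquivalent_of_induced [Fintype V] [Fintype W] {G : LoopGraph V}
    {G' : LoopGraph W} (g : W → V) (hg : g.Injective)
    (hadj : ∀ x y, G.Adj (g x) (g y) ↔ G'.Adj x y) (hloop : ∀ v, v ∉ Set.range g → G.Adj v v) :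
    HomotopyEquivalent G.ind G'.ind := by
  refine homotopyEquivalent_of_injective ⟨g, hg⟩ (fun s => ?_) (fun s hs v hv => ?_)
  · simp [ind, hadj]
  · by_contra h
    exact hs.2 v hv v hv (hloop v h)

/-- The disjoint union of a single edge, on the vertices `Sum.inl true` and `Sum.inl false`, with
the graph `G`. -/
def edgeSum (G : LoopGraph W) : LoopGraph (Bool ⊕ W) where
  Adj
    | .inl b, .inl c => b ≠ c
    | .inr x, .inr y => G.Adj x y
    | _, _ => False
  symm
    | .inl _, .inl _, h => Ne.symm h
    | .inr _, .inr _, h => G.symm _ _ h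

theorem ind_edgeSum (G : LoopGraph W) : G.edgeSum.ind = susp G.ind := by
  ext s
  have hL : (s.toLeft = ∅ ∨ s.toLeft ∈ twoPoints.faces) ↔
      ∀ b ∈ s.toLeft, ∀ c ∈ s.toLeft, ¬ b ≠ c := by
    generalize s.toLeft = t
    change (t = ∅ ∨ ∃ b, t = {b}) ↔ _
    revert t
    decide
  have hR : (s.toRight = ∅ ∨ s.toRight ∈ G.ind.faces) ↔
      ∀ x ∈ s.toRight, ∀ y ∈ s.toRight, ¬ G.Adj x y := by
    constructor
    · rintro (h | h)
      · simp [h]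
      · exact h.2
    · intro h
      exact s.toRight.eq_empty_or_nonempty.imp_right fun hne => ⟨hne, h⟩
  change (s.Nonempty ∧ _) ↔ (s.Nonempty ∧ _ ∧ _)
  rw [hL, hR]
  refine and_congr_right fun _ => ?_
  simp only [mem_toLeft, mem_toRight]
  constructor
  · exact fun h => ⟨fun b hb c hc => h _ hb _ hc, fun x hx y hy => h _ hx _ hy⟩
  · rintro ⟨h1, h2⟩ (b | x) hx (c | y) hy
    exacts [h1 b hx c hy, id, id, h2 x hx y hy]

/-! ### Local modifications -/

/-- Adjacency in the graph whose edges are the unordered pairs listed in `E`. -/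
def ListAdj (E : List (L × L)) (p q : L) : Prop := (p, q) ∈ E ∨ (q, p) ∈ E

instance [DecidableEq L] (E : List (L × L)) (p q : L) : Decidable (ListAdj E p q) :=
  inferInstanceAs (Decidable (_ ∨ _))

theorem ListAdj.symm {E : List (L × L)} {p q : L} (h : ListAdj E p q) : ListAdj E q p := Or.symm h

/-- The graph `H` together with the edges listed in `E`, which are written in terms of labels of
vertices. A vertex may carry several labels. -/
def glue (H : LoopGraph V) (ι : L → V) (E : List (L × L)) : LoopGraph V where
  Adj x y := H.Adj x y ∨ ∃ p q, ListAdj E p q ∧ ι p = x ∧ ι q = y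
  symm _ _ h := h.imp (H.symm _ _) fun ⟨p, q, h, hp, hq⟩ => ⟨q, p, h.symm, hq, hp⟩

/-- Two lists of edges with the same members. -/
def SameEdges (E E' : List (L × L)) : Prop := (∀ e ∈ E, e ∈ E') ∧ ∀ e ∈ E', e ∈ E

instance [DecidableEq L] (E E' : List (L × L)) : Decidable (SameEdges E E') :=
  inferInstanceAs (Decidable (_ ∧ _))

theorem glue_congr (H : LoopGraph V) (ι : L → V) {E E' : List (L × L)} (h : SameEdges E E') :
    glue H ι E = glue H ι E' := by
  have : ∀ p q, ListAdj E p q ↔ ListAdj E' p q := fun p q =>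
    ⟨Or.imp (h.1 _) (h.1 _), Or.imp (h.2 _) (h.2 _)⟩
  ext x y
  simp only [glue, this]

/-- The labels satisfying `I` are interior: the vertex that they name has no other label, and all
its edges in `glue H ι E` come from `E`. -/
structure IsInterior (H : LoopGraph V) (ι : L → V) (I : L → Bool) : Prop where
  not_adj : ∀ p, I p → ∀ y, ¬ H.Adj (ι p) y
  eq_of_eq : ∀ p q, I p → ι p = ι q → p = q

/-- The edges of `G` having no end with an interior label. -/
def exterior (G : LoopGraph V) (ι : L → V) (I : L → Bool) : LoopGraph V where
  Adj x y := G.Adj x y ∧ ∀ p, I p → ι p ≠ x ∧ ι p ≠ y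
  symm _ _ h := ⟨G.symm _ _ h.1, fun p hp => (h.2 p hp).symm⟩

theorem isInterior_exterior (G : LoopGraph V) {ι : L → V} {I : L → Bool}
    (h : ∀ p q, I p → ι p = ι q → p = q) : IsInterior (G.exterior ι I) ι I :=
  ⟨fun p hp _ hadj => (hadj.2 p hp).1 rfl, h⟩

theorem glue_exterior (G : LoopGraph V) (ι : L → V) (I : L → Bool) (E : List (L × L))
    (hE : ∀ p q, ListAdj E p q → G.Adj (ι p) (ι q))
    (hI : ∀ p y, I p → G.Adj (ι p) y → ∃ q, ListAdj E p q ∧ ι q = y) :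
    glue (G.exterior ι I) ι E = G := by
  ext x y
  constructor
  · rintro (h | ⟨p, q, h, rfl, rfl⟩)
    exacts [h.1, hE p q h]
  · intro h
    by_cases hx : ∃ p, I p ∧ ι p = x
    · obtain ⟨p, hp, rfl⟩ := hx
      obtain ⟨q, hq, rfl⟩ := hI p y hp h
      exact Or.inr ⟨p, q, hq, rfl, rfl⟩
    by_cases hy : ∃ p, I p ∧ ι p = y
    · obtain ⟨p, hp, rfl⟩ := hy
      obtain ⟨q, hq, rfl⟩ := hI p x hp (G.symm _ _ h)
      exact Or.inr ⟨q, p, hq.symm, rfl, rfl⟩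
    · exact Or.inl ⟨h, fun p hp => ⟨fun h' => hx ⟨p, hp, h'⟩, fun h' => hy ⟨p, hp, h'⟩⟩⟩

theorem IsInterior.glue_adj_iff {H : LoopGraph V} {ι : L → V} {I : L → Bool}
    (hI : IsInterior H ι I) (E : List (L × L)) {a : L} (ha : I a) (y : V) :
    (glue H ι E).Adj (ι a) y ↔ ∃ q, ListAdj E a q ∧ ι q = y := by
  constructor
  · rintro (h | ⟨p, q, h, hp, rfl⟩)
    · exact absurd h (hI.not_adj a ha y)
    · rw [hI.eq_of_eq a p ha hp.symm]
      exact ⟨q, h, rfl⟩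
  · rintro ⟨q, h, rfl⟩
    exact Or.inr ⟨a, q, h, rfl, rfl⟩

/-- The edges `pq` for `(p, q, a)` in the list `C` can be added to `E` one after the other, by
`ind_homotopyEquivalent_of_add_edge` with the interior label `a` as apex. -/
def ValidMoves (I : L → Bool) : List (L × L × L) → List (L × L) → Prop
  | [], _ => True
  | (p, q, a) :: C, E =>
    (I a ∧ a ≠ p ∧ a ≠ q ∧ ¬ ListAdj E a a ∧
      ∀ x, ListAdj E a x → ListAdj E x x ∨ ListAdj E p x ∨ ListAdj E q x) ∧
    ValidMoves I C ((p, q) :: E)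

instance ValidMoves.decidable [DecidableEq L] [Fintype L] (I : L → Bool) :
    ∀ (C : List (L × L × L)) (E : List (L × L)), Decidable (ValidMoves I C E)
  | [], _ => inferInstanceAs (Decidable True)
  | (p, q, _) :: C, E =>
    have := ValidMoves.decidable I C ((p, q) :: E)
    inferInstanceAs (Decidable (_ ∧ _))

/-- The edges added by a list of moves. -/
abbrev movedEdges (C : List (L × L × L)) : List (L × L) := C.map fun c => (c.1, c.2.1)

theorem IsInterior.homotopyEquivalent_of_validMoves [Fintype V] {H : LoopGraph V} {ι : L → V}
    {I : L → Bool} (hI : IsInterior H ι I) (C : List (L × L × L)) {E E' : List (L × L)}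
    (hC : ValidMoves I C E)
    (h : SameEdges (movedEdges C ++ E) E') :
    HomotopyEquivalent (glue H ι E).ind (glue H ι E').ind := by
  rw [← glue_congr H ι h]
  clear h
  induction C generalizing E with
  | nil => exact HomotopyEquivalent.refl _
  | cons c C ih =>
    obtain ⟨p, q, a⟩ := c
    obtain ⟨⟨hIa, hap, haq, haa, ha⟩, hC⟩ := hC
    have hperm : glue H ι (movedEdges ((p, q, a) :: C) ++ E) =
        glue H ι (movedEdges C ++ (p, q) :: E) := by
      refine glue_congr H ι ⟨?_, ?_⟩ <;> intro e <;>
        simp only [movedEdges, List.map_cons, List.cons_append, List.mem_cons, List.mem_append] <;>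
        tauto
    rw [hperm]
    refine HomotopyEquivalent.trans ?_ (ih hC)
    refine ind_homotopyEquivalent_of_add_edge (ι p) (ι q) (ι a)
      (fun h => hap (hI.eq_of_eq a p hIa h)) (fun h => haq (hI.eq_of_eq a q hIa h)) ?_ ?_ ?_
    · rw [hI.glue_adj_iff E hIa]
      rintro ⟨b, hb, hba⟩
      rw [← hI.eq_of_eq a b hIa hba.symm] at hb
      exact haa hb
    · intro x hx
      obtain ⟨b, hb, rfl⟩ := (hI.glue_adj_iff E hIa x).1 hx
      refine (ha b hb).imp ?_ (Or.imp ?_ ?_) <;> exact fun h => Or.inr ⟨_, _, h, rfl, rfl⟩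
    · intro x y
      constructor
      · rintro (h | ⟨p', q', h, rfl, rfl⟩)
        · exact Or.inl (Or.inl h)
        · simp only [ListAdj, List.mem_cons, Prod.mk.injEq] at h
          rcases h with (⟨rfl, rfl⟩ | h) | (⟨rfl, rfl⟩ | h)
          · simp
          · exact Or.inl (Or.inr ⟨_, _, Or.inl h, rfl, rfl⟩)
          · simp
          · exact Or.inl (Or.inr ⟨_, _, Or.inr h, rfl, rfl⟩)
      · rintro ((h | ⟨p', q', h, rfl, rfl⟩) | ⟨rfl, rfl⟩ | ⟨rfl, rfl⟩)
        · exact Or.inl h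
        · exact Or.inr ⟨p', q', h.imp (List.mem_cons_of_mem _) (List.mem_cons_of_mem _), rfl, rfl⟩
        · exact Or.inr ⟨p, q, Or.inl List.mem_cons_self, rfl, rfl⟩
        · exact Or.inr ⟨q, p, Or.inr List.mem_cons_self, rfl, rfl⟩

/-- The map `g` embeds `G'` as an induced subgraph of `G`, and the labels of the vertices in its
image all satisfy `K`. -/
structure InducedBy (G : LoopGraph V) (G' : LoopGraph W) (ι : L → V) (K : L → Bool) (g : W → V) :
    Prop where
  injective : g.Injective
  adj_iff : ∀ x y, G.Adj (g x) (g y) ↔ G'.Adj x y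
  label : ∀ q w, ι q = g w → K q

/-- The extension of `g : W → V` by the edge `ab`. -/
def withEdge (a b : V) (g : W → V) : Bool ⊕ W → V := Sum.elim (fun c => cond c a b) g

/-- The interior labels `a` and `b`, which do not satisfy `K`, are joined by an edge in `E`, carry
no loops, and have no neighbours satisfying `K`. -/
def IsFreeEdge (I K : L → Bool) (E : List (L × L)) (a b : L) : Prop :=
  (I a ∧ I b ∧ ¬ K a ∧ ¬ K b) ∧ ListAdj E a b ∧ ¬ ListAdj E a a ∧ ¬ ListAdj E b b ∧
    ∀ q, (ListAdj E a q → ¬ K q) ∧ (ListAdj E b q → ¬ K q)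

instance [DecidableEq L] [Fintype L] (I K : L → Bool) (E : List (L × L)) (a b : L) :
    Decidable (IsFreeEdge I K E a b) :=
  inferInstanceAs (Decidable (_ ∧ _))

/-- A free edge can be added to the induced subgraph as a new component. -/
theorem InducedBy.edgeSum {H : LoopGraph V} {ι : L → V} {I : L → Bool} (hI : IsInterior H ι I)
    [DecidableEq L] {E : List (L × L)} {G' : LoopGraph W} {K : L → Bool} {g : W → V}
    (hg : InducedBy (glue H ι E) G' ι K g) (a b : L) (h : IsFreeEdge I K E a b) :
    InducedBy (glue H ι E) G'.edgeSum ι (fun q => K q || q = a || q = b)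
      (withEdge (ι a) (ι b) g) := by
  obtain ⟨⟨hIa, hIb, hKa, hKb⟩, hab, haa, hbb, hN⟩ := h
  have hne : ι a ≠ ι b := fun h => by
    obtain rfl := hI.eq_of_eq a b hIa h
    exact haa hab
  have hga : ∀ w, ι a ≠ g w := fun w h => hKa (hg.label a w h)
  have hgb : ∀ w, ι b ≠ g w := fun w h => hKb (hg.label b w h)
  have hadj : ∀ p, I p → ∀ q, I q → ((glue H ι E).Adj (ι p) (ι q) ↔ ListAdj E p q) := by
    intro p hp q hq
    rw [hI.glue_adj_iff E hp]
    constructor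
    · rintro ⟨r, hr, h⟩
      rwa [hI.eq_of_eq q r hq h.symm]
    · exact fun h => ⟨q, h, rfl⟩
  have hnadj : ∀ c w, ¬ (glue H ι E).Adj (cond c (ι a) (ι b)) (g w) := by
    rintro (_ | _) w h
    · obtain ⟨q, hq, h⟩ := (hI.glue_adj_iff E hIb _).1 h
      exact (hN q).2 hq (hg.label q w h)
    · obtain ⟨q, hq, h⟩ := (hI.glue_adj_iff E hIa _).1 h
      exact (hN q).1 hq (hg.label q w h)
  refine ⟨?_, ?_, ?_⟩
  · refine Function.Injective.sumElim ?_ hg.injective ?_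
    · rintro (_ | _) (_ | _) h
      exacts [rfl, absurd h.symm hne, absurd h hne, rfl]
    · rintro (_ | _) w
      exacts [hgb w, hga w]
  · rintro (c | x) (d | y)
    · rcases c with _ | _ <;> rcases d with _ | _
      · exact iff_of_false (fun h => hbb ((hadj b hIb b hIb).1 h)) (fun h => h rfl)
      · exact iff_of_true ((hadj b hIb a hIa).2 hab.symm) Bool.false_ne_true
      · exact iff_of_true ((hadj a hIa b hIb).2 hab) Bool.false_ne_true.symm
      · exact iff_of_false (fun h => haa ((hadj a hIa a hIa).1 h)) (fun h => h rfl)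
    · exact iff_of_false (hnadj c y) id
    · exact iff_of_false (fun h => hnadj d x ((glue H ι E).symm _ _ h)) id
    · exact hg.adj_iff x y
  · rintro q ((_ | _) | w) h
    · simp [hI.eq_of_eq b q hIb h.symm]
    · simp [hI.eq_of_eq a q hIa h.symm]
    · simp [hg.label q w h]

/-! ### Grids `P_m × P_n` -/

section Path

theorem prod_path_adj {m n : ℕ} (x y : Fin m × Fin n) :
    ((path m).prod (path n)).Adj x y ↔
      ((x.1.val + 1 = y.1.val ∨ y.1.val + 1 = x.1.val) ∧ x.2 = y.2) ∨
      ((x.2.val + 1 = y.2.val ∨ y.2.val + 1 = x.2.val) ∧ x.1 = y.1) := by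
  simp only [prod, path, ofSimpleGraph, SimpleGraph.pathGraph_adj]

/-- Labels for the vertices in the last `k` columns of `P_m × P_{n+k}`. -/
def lastColumns (m n k : ℕ) (p : Fin m × Fin k) : Fin m × Fin (n + k) := (p.1, Fin.natAdd n p.2)

/-- The inclusion of the first `n` columns of `P_m × P_{n+k}`. -/
def firstColumns (m n k : ℕ) (p : Fin m × Fin n) : Fin m × Fin (n + k) := (p.1, Fin.castAdd k p.2)

/-- Among the last columns, all but the first one have no neighbour in the other columns. -/
def notFirst {m k : ℕ} (p : Fin m × Fin k) : Bool := p.2.val ≠ 0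

theorem lastColumns_injective (m n k : ℕ) : (lastColumns m n k).Injective := fun p q h => by
  simpa [lastColumns, Prod.ext_iff] using h

theorem isInterior_lastColumns (m n k : ℕ) :
    IsInterior (((path m).prod (path (n + k))).exterior (lastColumns m n k) notFirst)
      (lastColumns m n k) notFirst :=
  isInterior_exterior _ fun _ _ _ h => lastColumns_injective m n k h

theorem glue_lastColumns (m n k : ℕ) (E : List ((Fin m × Fin k) × (Fin m × Fin k)))
    (hE : ∀ p q, ListAdj E p q ↔
      ((p.1.val + 1 = q.1.val ∨ q.1.val + 1 = p.1.val) ∧ p.2 = q.2) ∨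
      ((p.2.val + 1 = q.2.val ∨ q.2.val + 1 = p.2.val) ∧ p.1 = q.1)) :
    glue (((path m).prod (path (n + k))).exterior (lastColumns m n k) notFirst)
      (lastColumns m n k) E = (path m).prod (path (n + k)) := by
  have key : ∀ p q, ListAdj E p q ↔
      ((path m).prod (path (n + k))).Adj (lastColumns m n k p) (lastColumns m n k q) := by
    intro p q
    simp only [hE, prod_path_adj, lastColumns, Fin.ext_iff, Fin.val_natAdd]
    omega
  refine glue_exterior _ _ _ _ (fun p q h => (key p q).1 h) fun p y hp h => ?_
  obtain ⟨q, rfl⟩ : ∃ q, lastColumns m n k q = y := by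
    have hy : n ≤ y.2.val := by
      simp only [notFirst, ne_eq, decide_not, Bool.not_eq_true', decide_eq_false_iff_not] at hp
      simp only [prod_path_adj, lastColumns, Fin.ext_iff, Fin.val_natAdd] at h
      omega
    refine ⟨(y.1, ⟨y.2.val - n, by omega⟩), ?_⟩
    ext <;> simp [lastColumns]
    omega
  exact ⟨q, (key p q).2 h, rfl⟩

theorem inducedBy_firstColumns (m n k : ℕ) (E : List ((Fin m × Fin k) × (Fin m × Fin k))) :
    InducedBy (glue (((path m).prod (path (n + k))).exterior (lastColumns m n k) notFirst)
      (lastColumns m n k) E) ((path m).prod (path n)) (lastColumns m n k) (fun _ => false)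
      (firstColumns m n k) := by
  have hne : ∀ q w, lastColumns m n k q ≠ firstColumns m n k w := fun q w h => by
    have := congrArg (fun v => v.2.val) h
    simp only [lastColumns, firstColumns, Fin.val_natAdd, Fin.val_castAdd] at this
    omega
  refine ⟨fun p q h => ?_, fun x y => ?_, fun q w h => absurd h (hne q w)⟩
  · simpa [firstColumns, Prod.ext_iff] using h
  · have hG : ((path m).prod (path (n + k))).Adj (firstColumns m n k x) (firstColumns m n k y) ↔
        ((path m).prod (path n)).Adj x y := by
      simp only [prod_path_adj, firstColumns, Fin.ext_iff, Fin.val_castAdd]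
    constructor
    · rintro (h | ⟨p, q, -, h, -⟩)
      exacts [hG.1 h.1, absurd h (hne p x)]
    · exact fun h => Or.inl ⟨hG.2 h, fun p _ => ⟨hne p x, hne p y⟩⟩

theorem exists_lastColumns_of_not_firstColumns {m n k : ℕ} (v : Fin m × Fin (n + k))
    (hv : ∀ w, firstColumns m n k w ≠ v) : ∃ q, lastColumns m n k q = v := by
  obtain ⟨i, j⟩ := v
  induction j using Fin.addCases with
  | left j => exact absurd rfl (hv (i, j))
  | right j => exact ⟨(i, j), rfl⟩

end Path

theorem ind_path_one (n : ℕ) : HomotopyEquivalent ((path 1).prod (path (n + 3))).ind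
    (susp ((path 1).prod (path n)).ind) := by
  let E : List ((Fin 1 × Fin 3) × (Fin 1 × Fin 3)) := [((0, 0), (0, 1)), ((0, 1), (0, 2))]
  rw [← glue_lastColumns 1 n 3 E (by decide), ← ind_edgeSum]
  have hI := isInterior_lastColumns 1 n 3
  refine (hI.homotopyEquivalent_of_validMoves [((0, 0), (0, 0), (0, 2))]
    (E' := ((0, 0), (0, 0)) :: E) (by decide) (by decide)).trans ?_
  have hg := (inducedBy_firstColumns 1 n 3 (((0, 0), (0, 0)) :: E)).edgeSum hI (0, 1) (0, 2)
    (by decide)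
  refine ind_homotopyEquivalent_of_induced _ hg.injective hg.adj_iff fun v hv => ?_
  obtain ⟨q, rfl⟩ := exists_lastColumns_of_not_firstColumns v fun w h => hv ⟨.inr w, h⟩
  have hq : ∀ q, q = (0, 1) ∨ q = (0, 2) ∨ ListAdj (((0, 0), (0, 0)) :: E) q q := by decide
  rcases hq q with rfl | rfl | h
  exacts [absurd ⟨.inl true, rfl⟩ hv, absurd ⟨.inl false, rfl⟩ hv, Or.inr ⟨q, q, h, rfl, rfl⟩]

theorem ind_path_two (n : ℕ) : HomotopyEquivalent ((path 2).prod (path (n + 2))).ind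
    (susp ((path 2).prod (path n)).ind) := by
  let E : List ((Fin 2 × Fin 2) × (Fin 2 × Fin 2)) :=
    [((0, 0), (1, 0)), ((0, 1), (1, 1)), ((0, 0), (0, 1)), ((1, 0), (1, 1))]
  let E' := ((0, 0), (0, 0)) :: ((1, 0), (1, 0)) :: E
  rw [← glue_lastColumns 2 n 2 E (by decide), ← ind_edgeSum]
  have hI := isInterior_lastColumns 2 n 2
  refine (hI.homotopyEquivalent_of_validMoves [((1, 0), (1, 0), (0, 1)), ((0, 0), (0, 0), (1, 1))]
    (E' := E') (by decide) (by decide)).trans ?_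
  have hg := (inducedBy_firstColumns 2 n 2 E').edgeSum hI (0, 1) (1, 1)
    (by decide)
  refine ind_homotopyEquivalent_of_induced _ hg.injective hg.adj_iff fun v hv => ?_
  obtain ⟨q, rfl⟩ := exists_lastColumns_of_not_firstColumns v fun w h => hv ⟨.inr w, h⟩
  have hq : ∀ q, q = (0, 1) ∨ q = (1, 1) ∨ ListAdj E' q q := by decide
  rcases hq q with rfl | rfl | h
  exacts [absurd ⟨.inl true, rfl⟩ hv, absurd ⟨.inl false, rfl⟩ hv, Or.inr ⟨q, q, h, rfl, rfl⟩]

theorem ind_path_three (n : ℕ) : HomotopyEquivalent ((path 3).prod (path (n + 4))).ind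
    (susp (susp (susp ((path 3).prod (path n)).ind))) := by
  let E : List ((Fin 3 × Fin 4) × (Fin 3 × Fin 4)) :=
    ([0, 1, 2, 3].flatMap fun j => [((0, j), (1, j)), ((1, j), (2, j))]) ++
    [0, 1, 2].flatMap fun i => [((i, 0), (i, 1)), ((i, 1), (i, 2)), ((i, 2), (i, 3))]
  rw [← glue_lastColumns 3 n 4 E (by decide)]
  have hI := isInterior_lastColumns 3 n 4
  -- Deleting `(1, 2)` creates the induced 8-cycle
  -- `(1, 1), (0, 1), (0, 2), (0, 3), (1, 3), (2, 3), (2, 2), (2, 1)`. It is cut off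
  -- by deleting column 0: the two edges added before each of these deletions turn the link of the
  -- vertex into a cone. The last move adds a chord.
  let C : List ((Fin 3 × Fin 4) × (Fin 3 × Fin 4) × (Fin 3 × Fin 4)) :=
    [((1, 2), (1, 2), (0, 3)),
      ((1, 0), (0, 3), (0, 1)), ((1, 0), (2, 2), (1, 3)), ((1, 0), (1, 0), (2, 1)),
      ((0, 0), (1, 3), (0, 2)), ((0, 0), (2, 1), (2, 3)), ((0, 0), (0, 0), (1, 1)),
      ((2, 0), (0, 2), (1, 1)), ((2, 0), (2, 3), (0, 3)), ((2, 0), (2, 0), (2, 2)),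
      ((1, 1), (1, 3), (0, 2))]
  let E₁ := movedEdges C ++ E
  refine (hI.homotopyEquivalent_of_validMoves C (E' := E₁) (by decide +kernel)
    (by decide +kernel)).trans ?_
  -- The chord `(1, 1), (1, 3)` replaces three vertices of the 8-cycle by a separate edge, leaving a
  -- 5-cycle, from which another edge is split off in the same way.
  let E₂ := E₁.erase ((0, 1), (1, 1))
  refine (hI.homotopyEquivalent_of_validMoves [((0, 1), (1, 1), (0, 3))] (E := E₂) (E' := E₁)
    (by decide +kernel) (by decide +kernel)).symm.trans ?_
  let E₃ := ((0, 3), (0, 3)) :: E₂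
  refine (hI.homotopyEquivalent_of_validMoves [((0, 3), (0, 3), (0, 1))] (E' := E₃)
    (by decide +kernel) (by decide +kernel)).trans ?_
  let E₄ := E₃.erase ((1, 1), (1, 3))
  refine (hI.homotopyEquivalent_of_validMoves [((1, 1), (1, 3), (2, 2))] (E := E₄) (E' := E₃)
    (by decide +kernel) (by decide +kernel)).symm.trans ?_
  let E₅ := ((2, 2), (2, 2)) :: E₄
  refine (hI.homotopyEquivalent_of_validMoves [((2, 2), (2, 2), (1, 3))] (E' := E₅)
    (by decide +kernel) (by decide +kernel)).trans ?_
  rw [← ind_edgeSum, ← ind_edgeSum, ← ind_edgeSum]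
  have hg := (((inducedBy_firstColumns 3 n 4 E₅).edgeSum hI (0, 1) (0, 2) (by decide +kernel)).edgeSum hI (1, 3) (2, 3)
    (by decide +kernel)).edgeSum hI (1, 1) (2, 1) (by decide +kernel)
  refine ind_homotopyEquivalent_of_induced _ hg.injective hg.adj_iff fun v hv => ?_
  obtain ⟨q, rfl⟩ :=
    exists_lastColumns_of_not_firstColumns v fun w h => hv ⟨.inr (.inr (.inr w)), h⟩
  have hq : ∀ q, q = (1, 1) ∨ q = (2, 1) ∨ q = (1, 3) ∨ q = (2, 3) ∨ q = (0, 1) ∨ q = (0, 2) ∨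
      ListAdj E₅ q q := by decide +kernel
  rcases hq q with rfl | rfl | rfl | rfl | rfl | rfl | h
  exacts [absurd ⟨.inl true, rfl⟩ hv, absurd ⟨.inl false, rfl⟩ hv,
    absurd ⟨.inr (.inl true), rfl⟩ hv, absurd ⟨.inr (.inl false), rfl⟩ hv,
    absurd ⟨.inr (.inr (.inl true)), rfl⟩ hv, absurd ⟨.inr (.inr (.inl false)), rfl⟩ hv,
    Or.inr ⟨q, q, h, rfl, rfl⟩]

/-! ### Grids `C_3 × C_n` -/

section Cycle

theorem prod_cycle_adj {m n : ℕ} (x y : Fin m × Fin n) :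
    ((cycle m).prod (cycle n)).Adj x y ↔
      (((x.1.val + 1) % m = y.1.val ∨ (y.1.val + 1) % m = x.1.val) ∧ x.2 = y.2) ∨
      (((x.2.val + 1) % n = y.2.val ∨ (y.2.val + 1) % n = x.2.val) ∧ x.1 = y.1) :=
  Iff.rfl

/-- Labels for the vertices in the columns `n, n + 1, …, n + 4` of `C_3 × C_{n+4}`. The column
`n + 4` is the column `0`, so its vertices carry two labels if `n = 0`. -/
def wrappedColumns (n : ℕ) (p : Fin 3 × Fin 5) : Fin 3 × Fin (n + 4) :=
  (p.1, ⟨(n + p.2.val) % (n + 4), Nat.mod_lt _ (by omega)⟩)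

/-- The middle three of the five labelled columns. -/
def inMiddle (p : Fin 3 × Fin 5) : Bool := p.2 ≠ 0 ∧ p.2 ≠ 4

theorem wrappedColumns_snd (n : ℕ) (p : Fin 3 × Fin 5) :
    p.2.val < 4 ∧ (wrappedColumns n p).2.val = n + p.2.val ∨
      p.2.val = 4 ∧ (wrappedColumns n p).2.val = 0 := by
  simp only [wrappedColumns]
  by_cases h : p.2.val < 4
  · exact Or.inl ⟨h, Nat.mod_eq_of_lt (by omega)⟩
  · have h4 : p.2.val = 4 := by omega
    exact Or.inr ⟨h4, by rw [h4, Nat.mod_self]⟩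

theorem inMiddle_iff (p : Fin 3 × Fin 5) : inMiddle p ↔ p.2.val ≠ 0 ∧ p.2.val ≠ 4 := by
  revert p; decide

theorem isInterior_wrappedColumns (n : ℕ) :
    IsInterior (((cycle 3).prod (cycle (n + 4))).exterior (wrappedColumns n) inMiddle)
      (wrappedColumns n) inMiddle := by
  refine isInterior_exterior _ fun p q hp h => ?_
  have h1 : (wrappedColumns n p).1 = (wrappedColumns n q).1 := by rw [h]
  have h2 : (wrappedColumns n p).2.val = (wrappedColumns n q).2.val := by rw [h]
  rw [inMiddle_iff] at hp
  have hp' := wrappedColumns_snd n p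
  have hq' := wrappedColumns_snd n q
  exact Prod.ext h1 (Fin.ext (by omega))

theorem add_one_mod_iff {n x y : ℕ} (hx : x < n) (hy : y < n) :
    (x + 1) % n = y ↔ x + 1 = y ∨ (x + 1 = n ∧ y = 0) := by
  rcases Nat.lt_or_ge (x + 1) n with h | h
  · rw [Nat.mod_eq_of_lt h]; omega
  · rw [show x + 1 = n by omega, Nat.mod_self]; omega

theorem glue_wrappedColumns (n : ℕ) (E : List ((Fin 3 × Fin 5) × (Fin 3 × Fin 5)))
    (hE : ∀ p q, ListAdj E p q ↔ p.1 ≠ q.1 ∧ p.2 = q.2 ∨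
      (p.2.val + 1 = q.2.val ∨ q.2.val + 1 = p.2.val) ∧ p.1 = q.1) :
    glue (((cycle 3).prod (cycle (n + 4))).exterior (wrappedColumns n) inMiddle)
      (wrappedColumns n) E = (cycle 3).prod (cycle (n + 4)) := by
  have h3 : ∀ i j : Fin 3, (((i.val + 1) % 3 = j.val ∨ (j.val + 1) % 3 = i.val) ↔ i ≠ j) := by
    decide
  refine glue_exterior _ _ _ _ (fun p q h => ?_) fun p y hp h => ?_
  · rw [prod_cycle_adj, h3, add_one_mod_iff (Fin.is_lt _) (Fin.is_lt _),
      add_one_mod_iff (Fin.is_lt _) (Fin.is_lt _)]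
    rcases (hE p q).1 h with ⟨h, h'⟩ | ⟨h, h'⟩
    · exact Or.inl ⟨h, by simp [wrappedColumns, h']⟩
    · have hp' := wrappedColumns_snd n p
      have hq' := wrappedColumns_snd n q
      exact Or.inr ⟨by omega, h'⟩
  · rw [inMiddle_iff] at hp
    have hp' := wrappedColumns_snd n p
    rw [prod_cycle_adj, h3, add_one_mod_iff (Fin.is_lt _) (Fin.is_lt _),
      add_one_mod_iff (Fin.is_lt _) (Fin.is_lt _)] at h
    have hlabel : ∀ k : Fin 5, (wrappedColumns n (y.1, k)).2.val = y.2.val →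
        wrappedColumns n (y.1, k) = y := fun k h => Prod.ext rfl (Fin.ext h)
    rcases h with ⟨h, h'⟩ | ⟨h | h, h'⟩
    · refine ⟨(y.1, p.2), (hE _ _).2 (Or.inl ⟨h, rfl⟩), hlabel _ ?_⟩
      rw [← h']; rfl
    · have hk : p.2.val + 1 < 5 := by omega
      refine ⟨(y.1, ⟨p.2.val + 1, hk⟩), (hE _ _).2 (Or.inr ⟨Or.inl rfl, h'⟩), hlabel _ ?_⟩
      have := wrappedColumns_snd n (y.1, ⟨p.2.val + 1, hk⟩)
      dsimp only at this
      omega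
    · have hk : p.2.val - 1 < 5 := by omega
      refine ⟨(y.1, ⟨p.2.val - 1, hk⟩), (hE _ _).2 (Or.inr ⟨Or.inr ?_, h'⟩), hlabel _ ?_⟩
      · dsimp only; omega
      · have := wrappedColumns_snd n (y.1, ⟨p.2.val - 1, hk⟩)
        dsimp only at this
        omega

/-- Once the first and the last of the five labelled columns have been joined, the columns
`0, …, n` induce `C_3 × C_{n+1}`. -/
theorem inducedBy_wrappedColumns (n : ℕ) (E : List ((Fin 3 × Fin 5) × (Fin 3 × Fin 5)))
    (hE : ∀ p q, ¬ inMiddle p → ¬ inMiddle q → (ListAdj E p q ↔ p.1 ≠ q.1 ∧ p.2 = q.2 ∨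
      p.2 ≠ q.2 ∧ p.1 = q.1)) :
    InducedBy (glue (((cycle 3).prod (cycle (n + 4))).exterior (wrappedColumns n) inMiddle)
      (wrappedColumns n) E) ((cycle 3).prod (cycle (n + 1))) (wrappedColumns n)
      (fun p => !inMiddle p) (firstColumns 3 (n + 1) 3) := by
  have hmid : ∀ q w, wrappedColumns n q = firstColumns 3 (n + 1) 3 w → ¬ inMiddle q := by
    intro q w h hq
    have h2 := congrArg (fun v => v.2.val) h
    simp only [firstColumns, Fin.val_castAdd] at h2
    have := wrappedColumns_snd n q
    rw [inMiddle_iff] at hq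
    omega
  have h3 : ∀ i j : Fin 3, (((i.val + 1) % 3 = j.val ∨ (j.val + 1) % 3 = i.val) ↔ i ≠ j) := by
    decide
  refine ⟨fun p q h => ?_, fun x y => ?_, fun q w h => by simpa using hmid q w h⟩
  · simpa [firstColumns, Prod.ext_iff] using h
  · have hG : ((cycle 3).prod (cycle (n + 4))).Adj (firstColumns 3 (n + 1) 3 x)
        (firstColumns 3 (n + 1) 3 y) ↔ x.1 ≠ y.1 ∧ x.2 = y.2 ∨
          (x.2.val + 1 = y.2.val ∨ y.2.val + 1 = x.2.val) ∧ x.1 = y.1 := by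
      rw [prod_cycle_adj, h3, add_one_mod_iff (Fin.is_lt _) (Fin.is_lt _),
        add_one_mod_iff (Fin.is_lt _) (Fin.is_lt _)]
      simp only [firstColumns, Fin.ext_iff, Fin.val_castAdd]
      omega
    have hG' : ((cycle 3).prod (cycle (n + 1))).Adj x y ↔ x.1 ≠ y.1 ∧ x.2 = y.2 ∨
        (x.2.val + 1 = y.2.val ∨ y.2.val + 1 = x.2.val ∨
          x.2.val = n ∧ y.2.val = 0 ∨ y.2.val = n ∧ x.2.val = 0) ∧ x.1 = y.1 := by
      rw [prod_cycle_adj, h3, add_one_mod_iff (Fin.is_lt _) (Fin.is_lt _),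
        add_one_mod_iff (Fin.is_lt _) (Fin.is_lt _)]
      omega
    rw [hG']
    constructor
    · rintro (h | ⟨p, q, hpq, hp, hq⟩)
      · have := hG.1 h.1
        tauto
      · have hp2 := congrArg (fun v => v.2.val) hp
        have hq2 := congrArg (fun v => v.2.val) hq
        have hp1 : p.1 = x.1 := congrArg Prod.fst hp
        have hq1 : q.1 = y.1 := congrArg Prod.fst hq
        simp only [firstColumns, Fin.val_castAdd] at hp2 hq2
        have hp' := wrappedColumns_snd n p
        have hq' := wrappedColumns_snd n q
        have hpm := hmid p x hp
        have hqm := hmid q y hq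
        rcases (hE p q hpm hqm).1 hpq with ⟨h, h'⟩ | ⟨h, h'⟩
        · refine Or.inl ⟨by rwa [← hp1, ← hq1], Fin.ext ?_⟩
          rw [← hp2, ← hq2]
          simp only [wrappedColumns, h']
        · rw [inMiddle_iff] at hpm hqm
          have h0 : p.2.val ≠ q.2.val := fun e => h (Fin.ext e)
          refine Or.inr ⟨?_, by rw [← hp1, ← hq1, h']⟩
          omega
    · have hext : ∀ z w : Fin 3 × Fin (n + 1),
          (((cycle 3).prod (cycle (n + 4))).Adj (firstColumns 3 (n + 1) 3 z)
            (firstColumns 3 (n + 1) 3 w)) →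
          (((cycle 3).prod (cycle (n + 4))).exterior (wrappedColumns n) inMiddle).Adj
            (firstColumns 3 (n + 1) 3 z) (firstColumns 3 (n + 1) 3 w) := fun z w h =>
        ⟨h, fun p hp => ⟨fun h' => hmid p z h' hp, fun h' => hmid p w h' hp⟩⟩
      have hlab : ∀ (z : Fin 3 × Fin (n + 1)) (k : Fin 5),
          (wrappedColumns n (z.1, k)).2.val = z.2.val →
          wrappedColumns n (z.1, k) = firstColumns 3 (n + 1) 3 z := fun z k h =>
        Prod.ext rfl (Fin.ext h)
      have h04 : ∀ i : Fin 3, ListAdj E (i, 0) (i, 4) := fun i =>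
        (hE _ _ (by simp [inMiddle]) (by simp [inMiddle])).2 (Or.inr ⟨by simp, rfl⟩)
      have h0 : ∀ i : Fin 3, (wrappedColumns n (i, 0)).2.val = n := fun i =>
        Nat.mod_eq_of_lt (by simp)
      have h4 : ∀ i : Fin 3, (wrappedColumns n (i, 4)).2.val = 0 := fun i => Nat.mod_self (n + 4)
      rintro (h | ⟨h | h | ⟨hx, hy⟩ | ⟨hy, hx⟩, h'⟩)
      · exact Or.inl (hext x y (hG.2 (Or.inl h)))
      · exact Or.inl (hext x y (hG.2 (Or.inr ⟨Or.inl h, h'⟩)))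
      · exact Or.inl (hext x y (hG.2 (Or.inr ⟨Or.inr h, h'⟩)))
      · exact Or.inr ⟨(x.1, 0), (y.1, 4), h' ▸ h04 x.1, hlab x 0 ((h0 x.1).trans hx.symm),
          hlab y 4 ((h4 y.1).trans hy.symm)⟩
      · exact Or.inr ⟨(x.1, 4), (y.1, 0), h' ▸ (h04 x.1).symm, hlab x 4 ((h4 x.1).trans hx.symm),
          hlab y 0 ((h0 y.1).trans hy.symm)⟩

theorem exists_wrappedColumns_of_not_firstColumns {n : ℕ} (v : Fin 3 × Fin (n + 4))
    (hv : ∀ w, firstColumns 3 (n + 1) 3 w ≠ v) :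
    ∃ q, inMiddle q ∧ wrappedColumns n q = v := by
  have hlt : n < v.2.val := by
    by_contra h
    exact hv (v.1, ⟨v.2.val, by omega⟩) rfl
  have hk : v.2.val - n < 5 := by omega
  refine ⟨(v.1, ⟨v.2.val - n, hk⟩), (inMiddle_iff _).2 ?_, Prod.ext rfl (Fin.ext ?_)⟩
  · dsimp only; omega
  · have := wrappedColumns_snd n (v.1, ⟨v.2.val - n, hk⟩)
    dsimp only at this
    omega

/-- The edges of a triangle in column `j`. -/
def triangle (j : Fin 5) : List ((Fin 3 × Fin 5) × (Fin 3 × Fin 5)) :=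
  [((0, j), (1, j)), ((0, j), (2, j)), ((1, j), (2, j))]

/-- The moves adding the edges between columns `j` and `k` inside each row, with apex in the same
row of column `l`. -/
def rungMoves (j k l : Fin 5) : List ((Fin 3 × Fin 5) × (Fin 3 × Fin 5) × (Fin 3 × Fin 5)) :=
  [0, 1, 2].map fun i => ((i, j), (i, k), (i, l))

/-- The moves adding all edges between different rows of columns `j` and `k`, with apex in the
third row of column `l`. -/
def crossMoves (j k l : Fin 5) : List ((Fin 3 × Fin 5) × (Fin 3 × Fin 5) × (Fin 3 × Fin 5)) :=
  [0, 1, 2].flatMap fun i =>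
    [((i, j), (i + 1, k), (i + 2, l)), ((i, j), (i + 2, k), (i + 1, l))]

theorem ind_cycle_three (n : ℕ) : HomotopyEquivalent ((cycle 3).prod (cycle (n + 4))).ind
    (susp (susp ((cycle 3).prod (cycle (n + 1))).ind)) := by
  -- Only the edges of the moves matter here, not the apices, which are set to an arbitrary column.
  let rung (j k : Fin 5) := movedEdges (rungMoves j k 0)
  let cross (j k : Fin 5) := movedEdges (crossMoves j k 0)
  let T := [0, 1, 2, 3, 4].flatMap triangle
  let E₀ := T ++ rung 0 1 ++ rung 1 2 ++ rung 2 3 ++ rung 3 4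
  rw [← glue_wrappedColumns n E₀ (by decide +kernel)]
  have hI := isInterior_wrappedColumns n
  -- The edges between columns 0 and 2 are added only to make room for those joining columns 0 and 4.
  let E₁ := cross 0 2 ++ E₀
  refine (hI.homotopyEquivalent_of_validMoves (crossMoves 0 2 1) (E' := E₁)
    (by decide +kernel) (by decide +kernel)).trans ?_
  let E₂ := rung 0 4 ++ E₁
  refine (hI.homotopyEquivalent_of_validMoves (rungMoves 0 4 2) (E' := E₂)
    (by decide +kernel) (by decide +kernel)).trans ?_
  let E₃ := rung 0 4 ++ E₀
  refine (hI.homotopyEquivalent_of_validMoves (crossMoves 0 2 1) (E := E₃) (E' := E₂)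
    (by decide +kernel) (by decide +kernel)).symm.trans ?_
  -- The edges between columns 1 and 3 allow the middle columns to be cut off from the others.
  let E₄ := cross 1 3 ++ E₃
  refine (hI.homotopyEquivalent_of_validMoves (crossMoves 1 3 2) (E' := E₄)
    (by decide +kernel) (by decide +kernel)).trans ?_
  let E₅ := T ++ rung 1 2 ++ rung 2 3 ++ cross 1 3 ++ rung 0 4
  refine (hI.homotopyEquivalent_of_validMoves (rungMoves 3 4 1 ++ rungMoves 0 1 3) (E := E₅)
    (E' := E₄) (by decide +kernel) (by decide +kernel)).symm.trans ?_
  -- The three middle columns now form a component, which is reduced to two disjoint edges.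
  let C : List ((Fin 3 × Fin 5) × (Fin 3 × Fin 5) × (Fin 3 × Fin 5)) :=
    [((0, 3), (0, 3), (0, 1)), ((1, 3), (1, 3), (1, 1)), ((2, 1), (2, 1), (2, 3))]
  let E₆ := movedEdges C ++ E₅
  refine (hI.homotopyEquivalent_of_validMoves C (E' := E₆)
    (by decide +kernel) (by decide +kernel)).trans ?_
  let E₇ := E₆.erase ((0, 2), (1, 2))
  refine (hI.homotopyEquivalent_of_validMoves [((0, 2), (1, 2), (2, 3))] (E := E₇) (E' := E₆)
    (by decide +kernel) (by decide +kernel)).symm.trans ?_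
  let E₈ := ((2, 3), (2, 3)) :: E₇
  refine (hI.homotopyEquivalent_of_validMoves [((2, 3), (2, 3), (0, 2))] (E' := E₈)
    (by decide +kernel) (by decide +kernel)).trans ?_
  let E₉ := E₈.erase ((0, 1), (1, 1))
  refine (hI.homotopyEquivalent_of_validMoves [((0, 1), (1, 1), (2, 2))] (E := E₉) (E' := E₈)
    (by decide +kernel) (by decide +kernel)).symm.trans ?_
  let F := ((2, 2), (2, 2)) :: E₉
  refine (hI.homotopyEquivalent_of_validMoves [((2, 2), (2, 2), (0, 1))] (E' := F)
    (by decide +kernel) (by decide +kernel)).trans ?_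
  rw [← ind_edgeSum, ← ind_edgeSum]
  have hg := ((inducedBy_wrappedColumns n F (by decide +kernel)).edgeSum hI (0, 1) (0, 2)
    (by decide +kernel)).edgeSum hI (1, 1) (1, 2) (by decide +kernel)
  refine ind_homotopyEquivalent_of_induced _ hg.injective hg.adj_iff fun v hv => ?_
  obtain ⟨q, hqm, rfl⟩ :=
    exists_wrappedColumns_of_not_firstColumns v fun w h => hv ⟨.inr (.inr w), h⟩
  have hq : ∀ q, inMiddle q → q = (1, 1) ∨ q = (1, 2) ∨ q = (0, 1) ∨ q = (0, 2) ∨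
      ListAdj F q q := by decide +kernel
  rcases hq q hqm with rfl | rfl | rfl | rfl | h
  exacts [absurd ⟨.inl true, rfl⟩ hv, absurd ⟨.inl false, rfl⟩ hv,
    absurd ⟨.inr (.inl true), rfl⟩ hv, absurd ⟨.inr (.inl false), rfl⟩ hv,
    Or.inr ⟨q, q, h, rfl, rfl⟩]

end Cycle

end LoopGraph

end HardSquares

open HardSquares LoopGraph in
theorem proposition1p2 :
    (∀ n : ℕ, HomotopyEquivalent
      ((path 1).prod (path (n + 3))).ind
      (susp ((path 1).prod (path n)).ind)) ∧
    (∀ n : ℕ, HomotopyEquivalent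
      ((path 2).prod (path (n + 2))).ind
      (susp ((path 2).prod (path n)).ind)) ∧
    (∀ n : ℕ, HomotopyEquivalent
      ((path 3).prod (path (n + 4))).ind
      (susp (susp (susp ((path 3).prod (path n)).ind)))) ∧
    (∀ n : ℕ, 1 ≤ n → HomotopyEquivalent
      ((cycle 3).prod (cycle (n + 3))).ind
      (susp (susp ((cycle 3).prod (cycle n)).ind))) := by
  refine ⟨ind_path_one, ind_path_two, ind_path_three, fun n hn => ?_⟩
  obtain ⟨n, rfl⟩ := Nat.exists_eq_add_of_le' hn
  exact ind_cycle_three n
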